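/- Let $G$ be a finite connected simple graph with exactly $h$ holes, where a hole is a chordless (induced) cycle of length at least $4$. Suppose that the holes of $G$ are pairwise edge-disjoint, that $G$ has at most one maximal clique with at least $3$ vertices, and that the clique number $\omega(G)$ of $G$ equals $h+1$. Let $K$ be any clique of $G$ with $|V(K)|=\omega(G)$. For a digraph $D$, let $C(D)$ denote its competition graph: it has the same vertex set as $D$, and two distinct vertices $x,y$ are adjacent in $C(D)$ if and only if there is a vertex $v$ such that $(x,v)$ and $(y,v)$ are arcs of $D$. Then there is an acyclic digraph $D$ such that $C(D)=G\cup\{i_1,i_2\}$, where $i_1,i_2$ are two new isolated vertices, and such that every vertex of $K$ has $i_2$ as an out-neighbor in $D$. In particular, $k(G)\le 2$, where the competition number $k(G)$ is the smallest $k$ such that $G$ together with $k$ new isolated vertices is the competition graph of an acyclic digraph. -/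

import Mathlib

namespace Digraph

/-- A digraph is acyclic if it has no directed cycle (in particular no loop): no vertex can be
reached from itself along a nonempty directed walk. -/
def IsAcyclic {V : Type*} (D : Digraph V) : Prop :=
  ∀ v : V, ¬ Relation.TransGen D.Adj v v

/-- The competition graph `C(D)`: two distinct vertices are adjacent if and only if they have a
common out-neighbor in `D`. -/
def competitionGraph {V : Type*} (D : Digraph V) : SimpleGraph V where
  Adj x y := x ≠ y ∧ ∃ v : V, D.Adj x v ∧ D.Adj y v
  symm := ⟨fun _ _ h => ⟨h.1.symm, h.2.imp fun _ hv => ⟨hv.2, hv.1⟩⟩⟩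
  loopless := ⟨fun _ h => h.1 rfl⟩

end Digraph

namespace SimpleGraph

/-- A hole of `G` is a chordless cycle of length at least `4`, viewed as a subgraph of `G`
(so that the starting point and the direction of a closed walk around it do not matter). -/
def IsHole {V : Type*} (G : SimpleGraph V) (H : G.Subgraph) : Prop :=
  ∃ (v : V) (p : G.Walk v v),
    p.IsCycle ∧ 4 ≤ p.length ∧ p.IsChordless ∧ p.toSubgraph = H

/-- The graph `G ∪ I_k`: the disjoint union of `G` and `k` new isolated vertices. -/
def addIsolated {V : Type*} (G : SimpleGraph V) (k : ℕ) : SimpleGraph (V ⊕ Fin k) :=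
  G ⊕g (⊥ : SimpleGraph (Fin k))

/-- The competition number `k(G)`: the smallest `k` such that `G` together with `k` new isolated
vertices is the competition graph of an acyclic digraph (`⊤` if there is no such `k`, which
does not happen for a finite graph). -/
noncomputable def competitionNumber {V : Type*} (G : SimpleGraph V) : ℕ∞ :=
  ⨅ k ∈ {k : ℕ | ∃ D : Digraph (V ⊕ Fin k), D.IsAcyclic ∧ D.competitionGraph = G.addIsolated k},
    (k : ℕ∞)

end SimpleGraph

/-! All triangles lie in `K`, so it suffices to let `K` prey on `i₂` and to give each edge outside
`K` a prey of its own. Such edges are few: modulo 2, triangles and holes generate the cycle space,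
so a weighting of these edges with zero sum on every hole is the coboundary of a potential vanishing
on `K`. Hence their number is at most `h + |V| - |K| = |V| - 1`. A greedy peeling by minimum degree
then finds distinct preys among `V` and `i₁`, each vertex of `V` being used only after the ends of
its edge, which gives acyclicity. -/

namespace SimpleGraph

/-! ### Cycle space modulo 2 -/

/-- A walk splits at any two positions into an initial, a middle and a final part. -/
lemma Walk.exists_append_append {V : Type*} {G : SimpleGraph V} {u v : V} (p : G.Walk u v)
    {i j : ℕ} (hij : i ≤ j) (hj : j ≤ p.length) :
    ∃ (a : G.Walk u (p.getVert i)) (m : G.Walk (p.getVert i) (p.getVert j))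
      (b : G.Walk (p.getVert j) v), p.edges = a.edges ++ (m.edges ++ b.edges) ∧
        a.length = i ∧ m.length = j - i ∧ b.length = p.length - j := by
  refine ⟨p.take i, ((p.drop i).take (j - i)).copy rfl (by simp [hij]), p.drop j, ?_, ?_, ?_, ?_⟩
  · rw [Walk.edges_copy, Walk.edges_take, Walk.edges_take, Walk.edges_drop, Walk.edges_drop]
    have : List.drop j p.edges = List.drop (j - i) (List.drop i p.edges) := by
      rw [List.drop_drop, Nat.add_sub_cancel' hij]
    rw [this, List.take_append_drop, List.take_append_drop]
  · simp; omega
  · simp; omega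
  · simp

/-- If a `ZMod 2`-valued function on edges sums to zero around every triangle and around every
chordless cycle of length at least `4`, then it sums to zero around every closed walk. -/
lemma Walk.sum_edges_eq_zero_of_chordless {V : Type*} {G : SimpleGraph V} (f : Sym2 V → ZMod 2)
    (htri : ∀ a b c, G.Adj a b → G.Adj b c → G.Adj c a → f s(a, b) + f s(b, c) + f s(c, a) = 0)
    (hhole : ∀ (v : V) (p : G.Walk v v), p.IsCycle → 4 ≤ p.length → p.IsChordless →
      (p.edges.map f).sum = 0)
    {v : V} (p : G.Walk v v) : (p.edges.map f).sum = 0 := by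
  induction hn : p.length using Nat.strong_induction_on generalizing v p with
  | _ n ih =>
  subst hn
  by_contra hp
  have hdouble : ∀ x : ZMod 2, x + x = 0 := by decide
  -- a shortcut between two positions contradicts minimality
  have hne : ∀ i j, i < j → j ≤ p.length → j - i < p.length → p.getVert i ≠ p.getVert j := by
    intro i j hij hj hlt heq
    obtain ⟨a, m, b, he, ha, hm, hb⟩ := p.exists_append_append hij.le hj
    have h1 := ih _ (by simp; omega) (m.copy rfl heq.symm) rfl
    have h2 := ih _ (by simp; omega) ((a.copy rfl heq).append b) rfl
    apply hp
    simp only [he, Walk.edges_append, Walk.edges_copy, List.map_append, List.sum_append] at h1 h2 ⊢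
    linear_combination h1 + h2
  -- A chord closes both pieces of `p` into shorter closed walks. It occurs once in each, so it
  -- cancels modulo 2.
  have hadj : ∀ i j, i + 1 < j → j ≤ p.length → j - i + 1 < p.length →
      ¬ G.Adj (p.getVert i) (p.getVert j) := by
    intro i j hij hj hlt hadj
    obtain ⟨a, m, b, he, ha, hm, hb⟩ := p.exists_append_append (by omega : i ≤ j) hj
    have h1 := ih _ (by simp; omega) (m.append (Walk.cons hadj.symm .nil)) rfl
    have h2 := ih _ (by simp; omega) (a.append (Walk.cons hadj b)) rfl
    apply hp
    simp only [he, Walk.edges_append, Walk.edges_cons, Walk.edges_nil, List.map_append,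
      List.map_cons, List.map_nil, List.sum_append, List.sum_cons, List.sum_nil,
      Sym2.eq_swap (a := p.getVert j)] at h1 h2 ⊢
    linear_combination h1 + h2 - hdouble (f s(p.getVert i, p.getVert j))
  have h3 : 3 ≤ p.length := by
    match p with
    | .nil => simp at hp
    | .cons h .nil => exact absurd h (G.loopless.irrefl _)
    | .cons h (.cons h' .nil) => simp [Sym2.eq_swap, hdouble] at hp
    | .cons h (.cons h' (.cons h'' q)) => simp
  have h4 : 4 ≤ p.length := by
    match p, h3 with
    | .cons h (.cons h' (.cons h'' .nil)), _ =>
      refine absurd (htri _ _ _ h h' h'') (by simpa [add_assoc] using hp)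
    | .cons h (.cons h' (.cons h'' (.cons h''' q))), _ => simp
  refine hp (hhole v p ?_ h4 ?_)
  · rw [Walk.isCycle_iff_isPath_tail_and_le_length]
    refine ⟨?_, h3⟩
    rw [← Walk.IsPath.getVert_injOn_iff]
    intro i hi j hj hij
    simp only [Set.mem_ofPred_eq, Walk.tail, Walk.drop_length, Walk.drop_getVert] at hi hj hij
    rcases lt_trichotomy i j with h | h | h
    · exact absurd hij (hne _ _ (by omega) (by omega) (by omega))
    · exact h
    · exact absurd hij.symm (hne _ _ (by omega) (by omega) (by omega))
  · rw [Walk.isChordless_iff_forall_mem_edges]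
    have key : ∀ i j, i ≤ p.length → j ≤ p.length → i < j →
        G.Adj (p.getVert i) (p.getVert j) → s(p.getVert i, p.getVert j) ∈ p.edges := by
      intro i j hi hj hij h
      rw [Walk.mk_mem_edges_iff_exists]
      by_cases h1 : j = i + 1
      · subst h1; exact ⟨i, by omega, rfl⟩
      by_cases h2 : j - i + 1 < p.length
      · exact absurd h (hadj i j (by omega) hj h2)
      -- Only the pairs at the closing point remain: `(0, n)`, `(1, n)` and `(0, n - 1)` with `n =
      -- p.length`.
      by_cases h5 : j = p.length
      · have hend : p.getVert j = p.getVert 0 := by simp [h5]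
        by_cases h6 : i = 0
        · subst h6; exact absurd hend.symm h.ne
        · obtain rfl : i = 1 := by omega
          exact ⟨0, by omega, by rw [hend, Sym2.eq_swap]⟩
      · obtain rfl : i = 0 := by omega
        refine ⟨j, by omega, ?_⟩
        rw [show j + 1 = p.length by omega, Walk.getVert_length, Walk.getVert_zero, Sym2.eq_swap]
    intro x y hx hy hxy
    obtain ⟨i, rfl, hi⟩ := Walk.mem_support_iff_exists_getVert.mp hx
    obtain ⟨j, rfl, hj⟩ := Walk.mem_support_iff_exists_getVert.mp hy
    rcases lt_trichotomy i j with h | h | h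
    · exact key i j hi hj h hxy
    · subst h; exact absurd rfl hxy.ne
    · rw [Sym2.eq_swap]; exact key j i hj hi h hxy.symm

/-- In a connected graph, an edge function with zero sum around all closed walks is the
coboundary of a function on the vertices vanishing at a given base point. -/
lemma Connected.exists_coboundary {V : Type*} {G : SimpleGraph V} (hconn : G.Connected)
    (f : Sym2 V → ZMod 2) (hf : ∀ (v : V) (p : G.Walk v v), (p.edges.map f).sum = 0) (o : V) :
    ∃ g : V → ZMod 2, g o = 0 ∧ ∀ x y, G.Adj x y → f s(x, y) = g x + g y := by
  have w : ∀ x, G.Walk o x := fun x => (hconn.preconnected o x).some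
  -- The chosen walk `w o` may be nontrivial, so `g o = 0` also relies on `hf`.
  refine ⟨fun x => ((w x).edges.map f).sum, hf _ _, fun x y hxy => ?_⟩
  have h := hf _ ((w x).append (Walk.cons hxy (w y).reverse))
  simp only [Walk.edges_append, Walk.edges_cons, Walk.edges_reverse, List.map_append,
    List.map_cons, List.map_reverse, List.sum_append, List.sum_cons, List.sum_reverse] at h
  beta_reduce
  generalize f s(x, y) = a at h ⊢
  generalize ((w x).edges.map f).sum = b at h ⊢
  generalize ((w y).edges.map f).sum = c at h ⊢
  revert a b c
  decide

/-! ### Counting the edges outside the clique -/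

/-- If every triangle of a connected graph `G` lies in the clique `K`, the number of edges of `G`
outside `K`, plus the order of `K`, is at most the number of vertices plus the number of holes. -/
lemma Connected.card_edges_outside_clique_add_card_le {V : Type*} [Fintype V] [DecidableEq V]
    {G : SimpleGraph V} (hconn : G.Connected) {h : ℕ}
    (hholes : {H : G.Subgraph | G.IsHole H}.encard = h) {K : Finset V} (hK : G.IsClique K)
    (hne : K.Nonempty)
    (htri : ∀ a b c, G.Adj a b → G.Adj b c → G.Adj c a → a ∈ K ∧ b ∈ K ∧ c ∈ K)
    (E : Finset (Sym2 V)) (hE : ∀ e, e ∈ E ↔ e ∈ G.edgeSet ∧ e ∉ K.sym2) :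
    E.card + K.card ≤ Fintype.card V + h := by
  classical
  have hfin : {H : G.Subgraph | G.IsHole H}.Finite :=
    Set.finite_of_encard_le_coe hholes.le
  have : Fintype {H : G.Subgraph | G.IsHole H} := hfin.fintype
  have hcard : Fintype.card {H : G.Subgraph | G.IsHole H} = h := by
    have := Set.encard_eq_coe_toFinset_card {H : G.Subgraph | G.IsHole H}
    rw [hholes, Set.toFinset_card] at this
    exact_mod_cast this.symm
  let ext : (E → ZMod 2) →ₗ[ZMod 2] (Sym2 V → ZMod 2) :=
    Function.ExtendByZero.linearMap (ZMod 2) (Subtype.val : E → Sym2 V)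
  -- `T` takes sums around holes; `D` is the coboundary on potentials that vanish on `K`.
  let T : (E → ZMod 2) →ₗ[ZMod 2] ({H : G.Subgraph | G.IsHole H} → ZMod 2) :=
    LinearMap.pi fun H => ∑ e with e ∈ H.1.edgeSet, LinearMap.proj e ∘ₗ ext
  let D : ({x // x ∉ K} → ZMod 2) →ₗ[ZMod 2] (E → ZMod 2) :=
    LinearMap.pi fun e => ∑ x with x ∈ e.1, LinearMap.proj x ∘ₗ
      Function.ExtendByZero.linearMap (ZMod 2) (Subtype.val : {x // x ∉ K} → V)
  have hker : LinearMap.ker T ≤ LinearMap.range D := by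
    intro f hf
    have hin : ∀ e : E, ext f e = f e := fun e =>
      Subtype.val_injective.extend_apply f (0 : Sym2 V → ZMod 2) e
    have hout : ∀ e, e ∉ E → ext f e = 0 := fun e he => by
      refine Function.extend_apply' f (0 : Sym2 V → ZMod 2) e ?_
      rintro ⟨a, rfl⟩; exact he a.2
    have hKzero : ∀ a ∈ K, ∀ b ∈ K, ext f s(a, b) = 0 := fun a ha b hb =>
      hout _ fun h => ((hE _).1 h).2 (by simp [ha, hb])
    have hclosed : ∀ (v : V) (p : G.Walk v v), (p.edges.map (ext f)).sum = 0 := by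
      intro v p
      refine Walk.sum_edges_eq_zero_of_chordless (ext f) ?_ ?_ p
      · intro a b c hab hbc hca
        obtain ⟨ha, hb, hc⟩ := htri a b c hab hbc hca
        simp [hKzero, ha, hb, hc]
      · intro v p hp h4 hch
        have h0 := congrFun (LinearMap.mem_ker.mp hf) ⟨p.toSubgraph, v, p, hp, h4, hch, rfl⟩
        simp only [T, LinearMap.pi_apply, LinearMap.sum_apply, LinearMap.comp_apply,
          LinearMap.proj_apply, Pi.zero_apply] at h0
        rw [← h0, ← List.sum_toFinset _ hp.edges_nodup]
        congr 1
        ext e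
        simp
    obtain ⟨o, ho⟩ := hne
    obtain ⟨g, hgo, hg⟩ := hconn.exists_coboundary (ext f) hclosed o
    have hgK : ∀ x ∈ K, g x = 0 := by
      intro x hx
      by_cases hxo : x = o
      · rw [hxo, hgo]
      · have := hg x o (hK hx ho hxo)
        rw [hKzero x hx o ho, hgo, add_zero] at this
        exact this.symm
    refine ⟨fun x => g x, ?_⟩
    have hext : Function.extend (Subtype.val : {x // x ∉ K} → V) (fun x => g x) (0 : V → ZMod 2) = g := by
      funext x
      by_cases hx : x ∈ K
      · rw [Function.extend_apply', hgK x hx]; · rfl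
        rintro ⟨a, rfl⟩; exact a.2 hx
      · exact Subtype.val_injective.extend_apply (fun x : {x // x ∉ K} => g x) (0 : V → ZMod 2) ⟨x, hx⟩
    funext ⟨e, he⟩
    induction e with
    | _ a b =>
    have hab : G.Adj a b := ((hE _).1 he).1
    have hfe := hin ⟨_, he⟩
    rw [hg a b hab] at hfe
    rw [← hfe]
    simp only [D, LinearMap.pi_apply, LinearMap.sum_apply, LinearMap.comp_apply,
      LinearMap.proj_apply, Function.ExtendByZero.linearMap_apply, hext]
    rw [← Finset.sum_pair hab.ne]
    congr 1
    ext x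
    simp
  -- `|E| = rank T + dim ker T ≤ h + (|V| - |K|)`.
  have h1 := LinearMap.finrank_range_add_finrank_ker T
  have h2 := Submodule.finrank_mono hker
  have h3 := LinearMap.finrank_range_le D
  have h4 := Submodule.finrank_le (LinearMap.range T)
  have h5 : Fintype.card {x // x ∉ K} + K.card = Fintype.card V := by
    rw [Fintype.card_subtype_compl, Fintype.card_coe]
    exact Nat.sub_add_cancel (Finset.card_le_univ K)
  simp only [Module.finrank_fintype_fun_eq_card, Fintype.card_coe] at h1 h2 h3 h4
  omega

end SimpleGraph

/-! ### Distinct labels by peeling -/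

/-- If `F` is a set of edges inside `S` with `#F + 2 ≤ #S + #A`, the edges of `F` can be given
distinct labels in `S` or in the reserve `A`, such that an edge labelled by a vertex of `S`
has both ends ranked below that vertex. -/
lemma exists_injOn_ranked_labelling {V W : Type*} [DecidableEq V] [DecidableEq W] (ι : V → W)
    (hι : Function.Injective ι) (S : Finset V) (F : Finset (Sym2 V)) (A : Finset W)
    (hdiag : ∀ e ∈ F, ¬ e.IsDiag) (hFS : ∀ e ∈ F, ∀ x ∈ e, x ∈ S) (hA : ∀ x ∈ S, ι x ∉ A)
    (hApos : 1 ≤ A.card) (hcard : F.card + 2 ≤ S.card + A.card) :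
    ∃ (φ : Sym2 V → W) (r : V → ℕ), Set.InjOn φ F ∧
      ∀ e ∈ F, φ e ∈ A ∨ ∃ u ∈ S, φ e = ι u ∧ ∀ x ∈ e, r x < r u := by
  induction hn : S.card generalizing S F A with
  | zero =>
    obtain rfl : F = ∅ := by
      refine Finset.eq_empty_of_forall_notMem fun e he => ?_
      have := hFS e he e.out.1 (Sym2.out_fst_mem e)
      simp [Finset.card_eq_zero.mp hn] at this
    obtain ⟨w, -⟩ := Finset.card_pos.mp hApos
    exact ⟨fun _ => w, fun _ => 0, by simp, by simp⟩
  | succ n ih =>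
    -- Otherwise double counting gives `s(a + 1) ≤ 2|F| ≤ 2(s + a - 2)`, that is `(s - 2)(a - 1) + 2
    -- ≤ 0`, with `s = |S|` and `a = |A|`. This is impossible for `s ≥ 2`; a single vertex carries
    -- no edge.
    have hdeg : ∃ v ∈ S, (F.filter (v ∈ ·)).card ≤ A.card := by
      by_contra! hcon
      have hsum : ∑ v ∈ S, (F.filter (v ∈ ·)).card = ∑ e ∈ F, (S.filter (· ∈ e)).card :=
        Finset.sum_card_bipartiteAbove_eq_sum_card_bipartiteBelow (fun v e => v ∈ e)
      have htwo : ∀ e ∈ F, (S.filter (· ∈ e)).card = 2 := by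
        intro e he
        have h1 := hdiag e he
        have h2 := hFS e he
        induction e with
        | _ a b =>
        rw [← Finset.card_pair (a := a) (b := b) (by simpa using h1)]
        congr 1
        ext x
        simp only [Finset.mem_filter, Sym2.mem_iff, Finset.mem_insert, Finset.mem_singleton]
        exact ⟨fun h => h.2, fun h => ⟨h2 x (by simpa using h), h⟩⟩
      rw [Finset.sum_congr rfl htwo, Finset.sum_const, smul_eq_mul] at hsum
      have hlow : S.card * (A.card + 1) ≤ F.card * 2 := by
        rw [← hsum, ← smul_eq_mul]
        exact Finset.card_nsmul_le_sum _ _ _ fun v hv => hcon v hv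
      rcases Nat.eq_zero_or_pos n with rfl | hnpos
      · obtain ⟨a, rfl⟩ := Finset.card_eq_one.mp hn
        have hF : F = ∅ := by
          refine Finset.eq_empty_of_forall_notMem fun e he => ?_
          have := htwo e he
          have h2 := (Finset.card_filter_le {a} (· ∈ e))
          simp at h2; omega
        simp [hF] at hlow
      · rw [hn] at hlow hcard
        nlinarith [Nat.mul_le_mul (hnpos) (hApos)]
    obtain ⟨v, hv, hvA⟩ := hdeg
    -- The edges at `v` use up `B`; then `v` leaves `S` and joins the reserve, which preserves both
    -- cardinality hypotheses.
    obtain ⟨B, hBA, hB⟩ := Finset.exists_subset_card_eq hvA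
    have hcardF := Finset.card_filter_add_card_filter_not (s := F) (v ∈ ·)
    have hιv : ι v ∉ A \ B := fun h => hA v hv (Finset.mem_sdiff.mp h).1
    have hAB := Finset.card_sdiff_add_card_eq_card hBA
    have hSv := Finset.card_erase_of_mem hv
    obtain ⟨φ, r, hinj, hφ⟩ := ih (S.erase v) (F.filter (v ∉ ·)) (insert (ι v) (A \ B))
      (fun e he => hdiag e (Finset.mem_filter.mp he).1)
      (fun e he x hx => by
        rw [Finset.mem_filter] at he
        exact Finset.mem_erase.mpr ⟨fun h => he.2 (h ▸ hx), hFS e he.1 x hx⟩)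
      (fun x hx => by
        rw [Finset.mem_erase] at hx
        simp [hι.eq_iff, hx.1, hA x hx.2])
      (by rw [Finset.card_insert_of_notMem hιv]; omega)
      (by rw [Finset.card_insert_of_notMem hιv]; omega)
      (by omega)
    let β := Finset.equivOfCardEq hB.symm
    obtain ⟨ψ, hψ⟩ : ∃ ψ : Sym2 V → W, ∀ e : (F.filter (v ∈ ·)), ψ e = β e :=
      ⟨fun e => if h : e ∈ F.filter (v ∈ ·) then β ⟨e, h⟩ else φ e, fun e => by simp [-Finset.mem_filter]⟩
    have hψB : ∀ e ∈ F, v ∈ e → ψ e ∈ B := fun e he hve => by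
      rw [hψ ⟨e, Finset.mem_filter.mpr ⟨he, hve⟩⟩]; exact (β _).2
    have hφB : ∀ e ∈ F, v ∉ e → φ e ∉ B := fun e he hve hB' => by
      rcases hφ e (Finset.mem_filter.mpr ⟨he, hve⟩) with h | ⟨u, hu, h, -⟩
      · rcases Finset.mem_insert.mp h with h | h
        · exact hA v hv (h ▸ hBA hB')
        · exact (Finset.mem_sdiff.mp h).2 hB'
      · exact hA u (Finset.mem_of_mem_erase hu) (h ▸ hBA hB')
    -- Ranking `v` above the rest of `S` allows it to label any edge that avoids it. Edges at `v`
    -- have labels in `A`, where no rank is required.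
    refine ⟨fun e => if v ∈ e then ψ e else φ e,
      Function.update r v ((S.erase v).sup r + 1), ?_, ?_⟩
    · intro e he e' he' hee
      rw [Finset.mem_coe] at he he'
      by_cases h : v ∈ e <;> by_cases h' : v ∈ e' <;> simp only [h, h', if_true, if_false] at hee
      · rw [hψ ⟨e, Finset.mem_filter.mpr ⟨he, h⟩⟩, hψ ⟨e', Finset.mem_filter.mpr ⟨he', h'⟩⟩] at hee
        exact congrArg Subtype.val (β.injective (Subtype.ext hee))
      · exact absurd (hee ▸ hψB e he h) (hφB e' he' h')
      · exact absurd (hee ▸ hψB e' he' h') (hφB e he h)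
      · exact hinj (by simp [he, h]) (by simp [he', h']) hee
    · intro e he
      by_cases h : v ∈ e
      · simp only [h, if_true]
        exact .inl (hBA (hψB e he h))
      simp only [h, if_false]
      have hne : ∀ x ∈ e, x ≠ v := fun x hx hxv => h (hxv ▸ hx)
      rcases hφ e (Finset.mem_filter.mpr ⟨he, h⟩) with h1 | ⟨u, hu, h1, h2⟩
      · rcases Finset.mem_insert.mp h1 with h1 | h1
        · refine .inr ⟨v, hv, h1, fun x hx => ?_⟩
          rw [Function.update_of_ne (hne x hx), Function.update_self, Nat.lt_succ_iff]
          exact Finset.le_sup (Finset.mem_erase.mpr ⟨hne x hx, hFS e he x hx⟩)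
        · exact .inl (Finset.mem_sdiff.mp h1).1
      · refine .inr ⟨u, Finset.mem_of_mem_erase hu, h1, fun x hx => ?_⟩
        rw [Function.update_of_ne (hne x hx), Function.update_of_ne (Finset.ne_of_mem_erase hu)]
        exact h2 x hx

/-! ### The digraph and the theorem -/

namespace SimpleGraph

/-- If the edges outside a clique `K` number less than the vertices, then `G` with two isolated
vertices is the competition graph of an acyclic digraph, with `K` preying on the second one. -/
lemma exists_isAcyclic_competitionGraph_eq_addIsolated_two {V : Type*} [Fintype V] [DecidableEq V]
    {G : SimpleGraph V} {K : Finset V} (hK : G.IsClique K)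
    (E : Finset (Sym2 V)) (hE : ∀ e, e ∈ E ↔ e ∈ G.edgeSet ∧ e ∉ K.sym2)
    (hcard : E.card + 1 ≤ Fintype.card V) :
    ∃ D : Digraph (V ⊕ Fin 2),
      D.IsAcyclic ∧ D.competitionGraph = G.addIsolated 2 ∧
        ∀ v ∈ K, D.Adj (Sum.inl v) (Sum.inr 1) := by
  obtain ⟨φ, r, hinj, hφ⟩ := exists_injOn_ranked_labelling (W := V ⊕ Fin 2) Sum.inl
    Sum.inl_injective Finset.univ E {Sum.inr 0}
    (fun e he => G.not_isDiag_of_mem_edgeSet ((hE e).1 he).1) (by simp) (by simp) (by simp)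
    (by simpa using hcard)
  have hφ1 : ∀ e ∈ E, φ e ≠ Sum.inr 1 := by
    intro e he h
    rcases hφ e he with h1 | ⟨u, -, h1, -⟩ <;> simp [h] at h1
  let D : Digraph (V ⊕ Fin 2) :=
    ⟨fun x w => ∃ a, x = Sum.inl a ∧ ((∃ e ∈ E, a ∈ e ∧ φ e = w) ∨ (a ∈ K ∧ w = Sum.inr 1))⟩
  refine ⟨D, ?_, ?_, fun v hv => ⟨v, rfl, .inr ⟨hv, rfl⟩⟩⟩
  -- Every arc raises `ρ`; the new vertices sit at `⊤` and have no prey.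
  · let ρ : V ⊕ Fin 2 → ℕ∞ := Sum.elim (fun a => (r a : ℕ∞)) fun _ => ⊤
    have hρ : ∀ x w, D.Adj x w → ρ x < ρ w := by
      rintro _ w ⟨a, rfl, ⟨e, he, hae, rfl⟩ | ⟨-, rfl⟩⟩
      · rcases hφ e he with h | ⟨u, -, h, hu⟩
        · rw [Finset.mem_singleton] at h
          simp [ρ, h]
        · simpa [ρ, h] using hu a hae
      · simp [ρ]
    have htrans : ∀ x w, Relation.TransGen D.Adj x w → ρ x < ρ w := by
      intro x w h
      induction h with
      | single h => exact hρ _ _ h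
      | tail _ h ih => exact ih.trans (hρ _ _ h)
    exact fun v h => lt_irrefl _ (htrans v v h)
  · ext x y
    constructor
    · rintro ⟨hxy, w, ⟨a, rfl, ha⟩, ⟨b, rfl, hb⟩⟩
      have hab : a ≠ b := fun h => hxy (h ▸ rfl)
      change G.Adj a b
      rcases ha with ⟨e, he, hae, rfl⟩ | ⟨ha, rfl⟩
      · rcases hb with ⟨e', he', hbe, hee⟩ | ⟨hb, h⟩
        -- As labels are distinct, two predators of one label are the ends of one edge.
        · obtain rfl := hinj he' he hee
          have := (hE _).1 he |>.1
          rwa [(Sym2.mem_and_mem_iff hab).1 ⟨hae, hbe⟩] at this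
        · exact absurd h (hφ1 e he)
      · rcases hb with ⟨e', he', hbe, hee⟩ | ⟨hb, -⟩
        · exact absurd hee (hφ1 e' he')
        · exact hK ha hb hab
    · match x, y with
      | .inl a, .inl b =>
        intro h
        have hab : G.Adj a b := h
        refine ⟨fun h => hab.ne (Sum.inl_injective h), ?_⟩
        by_cases hKab : s(a, b) ∈ K.sym2
        · rw [Finset.mk_mem_sym2_iff] at hKab
          exact ⟨.inr 1, ⟨a, rfl, .inr ⟨hKab.1, rfl⟩⟩, ⟨b, rfl, .inr ⟨hKab.2, rfl⟩⟩⟩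
        · have he : s(a, b) ∈ E := (hE _).2 ⟨hab, hKab⟩
          exact ⟨φ s(a, b), ⟨a, rfl, .inl ⟨_, he, by simp, rfl⟩⟩,
            ⟨b, rfl, .inl ⟨_, he, by simp, rfl⟩⟩⟩
      | .inl a, .inr i => intro h; simp [addIsolated] at h
      | .inr i, .inl a => intro h; simp [addIsolated] at h
      | .inr i, .inr j => intro h; simp [addIsolated] at h

/-- If all maximal cliques of order at least `3` coincide, every triangle lies in every clique
of maximum order. -/
lemma mem_of_triangle_of_isNClique_cliqueNum {V : Type*} [Finite V] {G : SimpleGraph V}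
    (hclique : ∀ K₁ K₂ : Finset V, Maximal (fun s : Finset V => G.IsClique s) K₁ → 3 ≤ K₁.card →
      Maximal (fun s : Finset V => G.IsClique s) K₂ → 3 ≤ K₂.card → K₁ = K₂)
    {K : Finset V} (hK : G.IsNClique G.cliqueNum K) {a b c : V}
    (hab : G.Adj a b) (hbc : G.Adj b c) (hca : G.Adj c a) : a ∈ K ∧ b ∈ K ∧ c ∈ K := by
  classical
  have htri : G.IsNClique 3 {a, b, c} := is3Clique_triple_iff.2 ⟨hab, hca.symm, hbc⟩
  obtain ⟨M, hle, hM⟩ := (Set.toFinite {s : Finset V | G.IsClique s}).exists_le_maximal htri.isClique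
  have hKmax : Maximal (fun s : Finset V => G.IsClique s) K := by
    refine ⟨hK.isClique, fun T hT hKT => (Finset.eq_of_subset_of_card_le hKT ?_).ge⟩
    rw [hK.card_eq]
    exact hT.card_le_cliqueNum
  -- The triangle itself forces the clique number up to `3`, so uniqueness applies to `K`.
  have h3 : 3 ≤ K.card := by
    rw [hK.card_eq, ← htri.card_eq]
    exact htri.isClique.card_le_cliqueNum
  obtain rfl := hclique M K hM (htri.card_eq ▸ Finset.card_le_card hle) hKmax h3
  exact ⟨hle (by simp), hle (by simp), hle (by simp)⟩

end SimpleGraph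

theorem theorem1 {V : Type*} [Finite V] (G : SimpleGraph V) (h : ℕ)
    (hconn : G.Connected)
    (hholes : {H : G.Subgraph | G.IsHole H}.encard = h)
    (hdisj : ∀ H₁ H₂ : G.Subgraph, G.IsHole H₁ → G.IsHole H₂ → H₁ ≠ H₂ →
      Disjoint H₁.edgeSet H₂.edgeSet)
    (hclique : ∀ K₁ K₂ : Finset V, Maximal (fun s : Finset V => G.IsClique s) K₁ → 3 ≤ K₁.card →
      Maximal (fun s : Finset V => G.IsClique s) K₂ → 3 ≤ K₂.card → K₁ = K₂)
    (hω : G.cliqueNum = h + 1) :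
    (∀ K : Finset V, G.IsNClique G.cliqueNum K →
      ∃ D : Digraph (V ⊕ Fin 2),
        D.IsAcyclic ∧ D.competitionGraph = G.addIsolated 2 ∧
          ∀ v ∈ K, D.Adj (Sum.inl v) (Sum.inr 1)) ∧
    G.competitionNumber ≤ 2 := by
  classical
  have := Fintype.ofFinite V
  have key : ∀ K : Finset V, G.IsNClique G.cliqueNum K →
      ∃ D : Digraph (V ⊕ Fin 2),
        D.IsAcyclic ∧ D.competitionGraph = G.addIsolated 2 ∧
          ∀ v ∈ K, D.Adj (Sum.inl v) (Sum.inr 1) := by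
    intro K hK
    have hKcard : K.card = h + 1 := hK.card_eq.trans hω
    have hE : ∀ e, e ∈ G.edgeFinset \ K.sym2 ↔ e ∈ G.edgeSet ∧ e ∉ K.sym2 := by simp
    have hle := hconn.card_edges_outside_clique_add_card_le hholes hK.isClique
      (Finset.card_pos.1 (by omega))
      (fun a b c => SimpleGraph.mem_of_triangle_of_isNClique_cliqueNum hclique hK) _ hE
    exact SimpleGraph.exists_isAcyclic_competitionGraph_eq_addIsolated_two hK.isClique _ hE
      (by omega)
  refine ⟨key, ?_⟩
  obtain ⟨K, hK⟩ := G.exists_isNClique_cliqueNum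
  obtain ⟨D, hD, hDG, -⟩ := key K hK
  exact iInf₂_le (2 : ℕ) ⟨D, hD, hDG⟩
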